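/- A semilattice is a commutative semigroup all of whose elements are idempotent, and a subsemilattice of a semigroup $S$ is a subsemigroup of $S$ that is a semilattice. A (nonempty) semigroup $S$ is called semilattice indecomposable (s-indecomposable) if every semilattice that is a homomorphic image of $S$ has only one element. (i) If $S$ is a finite s-indecomposable semigroup and $Y$ is a subsemilattice of $S$, then $$|Y|\le 2\left\lfloor\frac{|S|-1}{4}\right\rfloor+1.$$ (ii) For every integer $n\ge 1$ there is an s-indecomposable semigroup $S$ with $|S|=n$ and a subsemilattice $Y$ of $S$ with $$|Y|=2\left\lfloor\frac{|S|-1}{4}\right\rfloor+1.$$ -/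

import Mathlib

universe u

/-- A (multiplicatively written) semigroup is a *semilattice* if it is commutative and each of its
elements is idempotent. -/
def IsSemilattice (T : Type u) [Semigroup T] : Prop :=
  (∀ a : T, a * a = a) ∧ ∀ a b : T, a * b = b * a

/-- A semigroup `S` is *semilattice indecomposable* if every semilattice homomorphic image of `S`
is trivial. A homomorphic image of `S` is never larger than `S`, so it is enough to consider
images in the universe of `S`. -/
def SIndecomposable (S : Type u) [Semigroup S] : Prop :=
  ∀ (T : Type u) [Semigroup T], IsSemilattice T →
    ∀ f : S →ₙ* T, Function.Surjective f → Subsingleton T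

/-!
**Upper bound.** Write `a ∣ b` (here `TwoSidedDvd a b`) for `b ∈ S a S`. For an idempotent `e`,
the elements `x` with `x ∣ e` and `e ∣ x` form the `𝒥`-class `J` of `e`. In a finite semigroup an
idempotent `p ≤ e` in the same `𝒥`-class equals `e` (`eq_of_le_of_twoSidedDvd`), so commuting
idempotents in one `𝒥`-class have a product that falls outside of it. Consequently

* if `Y` meets `J` in `d` elements, these lie in distinct `ℛ`-classes and in distinct `ℒ`-classes,
  so `d ^ 2 ≤ |J|` (`card_sq_le_card_jClass`);
* `Y` meets the minimal `𝒥`-class in at most one element;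
* if `J` is not minimal, the complement of `{x | x ∣ e}` is a nonempty ideal, which is not
  completely prime when `S` is s-indecomposable. This yields idempotents `h, g ∈ J` with
  `h g ∉ J`; they differ both in their `ℛ`- and in their `ℒ`-class, so `4 ≤ |J|`
  (`four_le_card_jClass`).

Hence `4 * ⌈d / 2⌉ ≤ |J|` for each non-minimal `J` that meets `Y`. Summing over these classes, and
adding one element of the minimal ideal, gives the bound.

**Sharpness.** The `0`-direct union of `k` copies of the five-element Brandt semigroup and a null
semigroup with `r` nonzero elements (`BrandtSum`) has `4 * k + r + 1` elements. A semilattice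
image of it is trivial, because nilpotent elements go to the image of `0` and every nonzero
idempotent is a product of two nilpotent elements. Its idempotents form a semilattice with
`2 * k + 1` elements.
-/

/-! ### Two-sided divisibility and `𝒥`-classes of idempotents -/

section JClass

variable {S : Type u} [Semigroup S]

/-- `b` lies in `S a S`. No identity is adjoined to `S`, so the relation need not be reflexive;
it is so on idempotents. -/
def TwoSidedDvd (a b : S) : Prop := ∃ u v, u * a * v = b

theorem TwoSidedDvd.trans {a b c : S} (h₁ : TwoSidedDvd a b) (h₂ : TwoSidedDvd b c) :
    TwoSidedDvd a c := by
  obtain ⟨u, v, rfl⟩ := h₁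
  obtain ⟨x, y, rfl⟩ := h₂
  exact ⟨x * u, v * y, by simp only [mul_assoc]⟩

theorem TwoSidedDvd.of_mul_left {a b c : S} (h : TwoSidedDvd (a * b) c) : TwoSidedDvd a c := by
  obtain ⟨u, v, rfl⟩ := h
  exact ⟨u, b * v, by simp only [mul_assoc]⟩

theorem TwoSidedDvd.of_mul_right {a b c : S} (h : TwoSidedDvd (a * b) c) : TwoSidedDvd b c := by
  obtain ⟨u, v, rfl⟩ := h
  exact ⟨u * a, v, by simp only [mul_assoc]⟩

theorem twoSidedDvd_self {e : S} (he : e * e = e) : TwoSidedDvd e e := ⟨e, e, by rw [he, he]⟩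

/-- For idempotent `e`, the `𝒥`-class of `e`. -/
def jClass (e : S) : Set S := {x | TwoSidedDvd x e ∧ TwoSidedDvd e x}

theorem jClass_eq_of_mem {e f x : S} (hx : x ∈ jClass e) (hx' : x ∈ jClass f) :
    jClass e = jClass f := by
  have hef : TwoSidedDvd e f := hx.2.trans hx'.1
  have hfe : TwoSidedDvd f e := hx'.2.trans hx.1
  ext y
  exact ⟨fun h => ⟨h.1.trans hef, hfe.trans h.2⟩, fun h => ⟨h.1.trans hfe, hef.trans h.2⟩⟩

/-- In a finite semigroup, an idempotent is minimal among the idempotents of its `𝒥`-class for the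
order `p ≤ e ↔ e * p = p = p * e`. -/
theorem eq_of_le_of_twoSidedDvd [Finite S] {e p : S} (he : e * e = e) (hp : p * p = p)
    (hep : e * p = p) (hpe : p * e = p) (h : TwoSidedDvd p e) : p = e := by
  obtain ⟨a, b, hab⟩ := h
  -- `v = p * b * e` has the left inverse `e * a * p` in the finite local monoid at `e`; hence it
  -- also has a right inverse, which puts `e` into `p * S`.
  let v : S := p * b * e
  have huv : e * a * p * v = e := by
    calc e * a * p * (p * b * e) = e * (a * (p * p) * b) * e := by simp only [mul_assoc]
      _ = e := by rw [hp, hab, he, he]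
  have hev : e * v = v := by
    calc e * (p * b * e) = (e * p) * b * e := by simp only [mul_assoc]
      _ = v := by rw [hep]
  let L : {x : S // e * x = x} → {x : S // e * x = x} :=
    fun x => ⟨v * x.1, by rw [← mul_assoc, hev]⟩
  have hL : Function.Injective L := by
    intro x y hxy
    have hxy' : v * x.1 = v * y.1 := congrArg Subtype.val hxy
    have h2 : e * a * p * (v * x.1) = e * a * p * (v * y.1) := by rw [hxy']
    rw [← mul_assoc _ v, ← mul_assoc _ v, huv, x.2, y.2] at h2
    exact Subtype.ext h2
  obtain ⟨x, hx⟩ := Finite.surjective_of_injective hL ⟨e, he⟩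
  have hx' : p * b * e * x.1 = e := congrArg Subtype.val hx
  calc p = p * (p * b * e * x.1) := by rw [hx', hpe]
    _ = (p * p) * b * e * x.1 := by simp only [mul_assoc]
    _ = e := by rw [hp, hx']

theorem eq_of_comm_of_twoSidedDvd_mul [Finite S] {e f : S} (he : e * e = e) (hf : f * f = f)
    (hc : e * f = f * e) (h₁ : TwoSidedDvd (e * f) e) (h₂ : TwoSidedDvd (e * f) f) : e = f := by
  have h1 : e * (e * f) = e * f := by rw [← mul_assoc, he]
  have h2 : (e * f) * f = e * f := by rw [mul_assoc, hf]
  have h3 : (e * f) * e = e * f := by rw [mul_assoc, ← hc, h1]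
  have h4 : f * (e * f) = e * f := by rw [← mul_assoc, ← hc, h2]
  have h5 : (e * f) * (e * f) = e * f := by rw [← mul_assoc, h3, h2]
  rw [← eq_of_le_of_twoSidedDvd he h5 h1 h3 h₁]
  exact eq_of_le_of_twoSidedDvd hf h5 h4 h2 h₂

/-- In a finite semigroup, `𝒥`-equivalent idempotents are `𝒟`-equivalent: `u` lies in the
`ℛ`-class of `f` and the `ℒ`-class of `e`, and `v` is its inverse. -/
theorem exists_mul_eq_of_mem_jClass [Finite S] {e f : S} (he : e * e = e) (hf : f * f = f)
    (h : f ∈ jClass e) :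
    ∃ u v, u * v = f ∧ v * u = e ∧ f * u = u ∧ u * e = u ∧ e * v = v ∧ v * f = v := by
  obtain ⟨hfe, x, y, hxy⟩ := h
  obtain ⟨u, hu⟩ : ∃ u, u = f * x * e := ⟨_, rfl⟩
  obtain ⟨v, hv⟩ : ∃ v, v = e * y * f := ⟨_, rfl⟩
  have huv : u * v = f := by
    calc u * v = f * (x * (e * e) * y) * f := by simp only [hu, hv, mul_assoc]
      _ = f := by rw [he, hxy, hf, hf]
  have hfu : f * u = u := by rw [hu, ← mul_assoc, ← mul_assoc, hf]
  have hue : u * e = u := by rw [hu, mul_assoc, he]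
  have hev : e * v = v := by rw [hv, ← mul_assoc, ← mul_assoc, he]
  have hvf : v * f = v := by rw [hv, mul_assoc, hf]
  refine ⟨u, v, huv, ?_, hfu, hue, hev, hvf⟩
  refine eq_of_le_of_twoSidedDvd he ?_ ?_ ?_ (TwoSidedDvd.trans ⟨u, v, ?_⟩ hfe)
  · rw [mul_assoc, ← mul_assoc u, huv, hfu]
  · rw [← mul_assoc, hev]
  · rw [mul_assoc, hue]
  · rw [← mul_assoc, huv, mul_assoc, huv, hf]

/-! ### Lower bounds for the size of a `𝒥`-class -/

/-- Commuting idempotents `f` and `g` of one `𝒥`-class determine an element in the intersection of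
the `ℛ`-class of `f` and the `ℒ`-class of `g`, and distinct pairs give distinct elements. -/
theorem card_sq_le_card_jClass [Finite S] {e : S} (he : e * e = e) (Z : Finset S)
    (hZ : ∀ f ∈ Z, f * f = f) (hc : ∀ f ∈ Z, ∀ g ∈ Z, f * g = g * f)
    (hJ : ∀ f ∈ Z, f ∈ jClass e) : Z.card ^ 2 ≤ (jClass e).ncard := by
  have key := fun f : Z => exists_mul_eq_of_mem_jClass he (hZ f f.2) (hJ f f.2)
  choose u v huv hvu hfu hue hev hvf using key
  have hmem : ∀ i j : Z, u i * v j ∈ jClass e := fun i j =>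
    ⟨⟨v i, u j, by rw [← mul_assoc, hvu, mul_assoc, hvu, he]⟩, ⟨u i, v j, by rw [hue]⟩⟩
  let φ : Z × Z → jClass e := fun p => ⟨u p.1 * v p.2, hmem p.1 p.2⟩
  have hφ : Function.Injective φ := by
    rintro ⟨i, j⟩ ⟨k, l⟩ h
    have h' : u i * v j = u k * v l := congrArg Subtype.val h
    obtain ⟨z, hz⟩ : ∃ z, z = u i * v j := ⟨_, rfl⟩
    have hze : TwoSidedDvd z e := hz ▸ (hmem i j).1
    have hi : i.1 * z = z := by rw [hz, ← mul_assoc, hfu]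
    have hk : k.1 * z = z := by rw [hz, h', ← mul_assoc, hfu]
    have hj : z * j.1 = z := by rw [hz, mul_assoc, hvf]
    have hl : z * l.1 = z := by rw [hz, h', mul_assoc, hvf]
    have hik : TwoSidedDvd (i.1 * k.1) e :=
      TwoSidedDvd.trans ⟨i, z, by rw [mul_assoc, mul_assoc, hk, hi, hi]⟩ hze
    have hjl : TwoSidedDvd (j.1 * l.1) e :=
      TwoSidedDvd.trans ⟨z, l, by rw [← mul_assoc, hj, hl, hl]⟩ hze
    have h1 := eq_of_comm_of_twoSidedDvd_mul (hZ i i.2) (hZ k k.2) (hc i i.2 k k.2)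
      (hik.trans (hJ i i.2).2) (hik.trans (hJ k k.2).2)
    have h2 := eq_of_comm_of_twoSidedDvd_mul (hZ j j.2) (hZ l l.2) (hc j j.2 l l.2)
      (hjl.trans (hJ j j.2).2) (hjl.trans (hJ l l.2).2)
    rw [Subtype.ext h1, Subtype.ext h2]
  have := Nat.card_le_card_of_injective φ hφ
  rw [Nat.card_prod, Nat.card_eq_fintype_card, Fintype.card_coe, Nat.card_coe_set_eq] at this
  rwa [sq]

/-- If the divisors of `e` were closed under multiplication, their indicator function would be a
homomorphism onto the two-element semilattice. -/
theorem SIndecomposable.exists_not_twoSidedDvd_mul (hS : SIndecomposable S) {e t : S}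
    (he : e * e = e) (ht : ¬ TwoSidedDvd t e) :
    ∃ x y, TwoSidedDvd x e ∧ TwoSidedDvd y e ∧ ¬ TwoSidedDvd (x * y) e := by
  classical
  by_contra! H
  -- The multiplicative semigroup of `ZMod 2` serves as the two-element semilattice.
  have hT : IsSemilattice (ULift.{u} (ZMod 2)) := by
    refine ⟨fun a => ?_, fun a b => mul_comm a b⟩
    obtain ⟨a⟩ := a
    refine ULift.ext _ _ (?_ : a * a = a)
    revert a; decide
  let f : S →ₙ* ULift.{u} (ZMod 2) :=
    { toFun := fun x => ⟨if TwoSidedDvd x e then 1 else 0⟩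
      map_mul' := by
        intro x y
        refine ULift.ext _ _ ?_
        change (if TwoSidedDvd (x * y) e then (1 : ZMod 2) else 0) =
          (if TwoSidedDvd x e then 1 else 0) * (if TwoSidedDvd y e then 1 else 0)
        by_cases hx : TwoSidedDvd x e
        · by_cases hy : TwoSidedDvd y e
          · simp [hx, hy, H x y hx hy]
          · have : ¬ TwoSidedDvd (x * y) e := fun h => hy h.of_mul_right
            simp [hy, this]
        · have : ¬ TwoSidedDvd (x * y) e := fun h => hx h.of_mul_left
          simp [hx, this] }
  have hfe : f e = ⟨1⟩ := by
    change (⟨if TwoSidedDvd e e then 1 else 0⟩ : ULift (ZMod 2)) = ⟨1⟩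
    rw [if_pos (twoSidedDvd_self he)]
  have hft : f t = ⟨0⟩ := by
    change (⟨if TwoSidedDvd t e then 1 else 0⟩ : ULift (ZMod 2)) = ⟨0⟩
    rw [if_neg ht]
  have hf : Function.Surjective f := by
    rintro ⟨a⟩
    have : a = 0 ∨ a = 1 := by revert a; decide
    rcases this with rfl | rfl
    · exact ⟨t, hft⟩
    · exact ⟨e, hfe⟩
  have hsub := hS _ hT f hf
  have h10 : (⟨1⟩ : ULift.{u} (ZMod 2)) = ⟨0⟩ := Subsingleton.elim _ _
  exact absurd (congrArg ULift.down h10) (by decide)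

/-- A non-minimal regular `𝒥`-class of an s-indecomposable semigroup is not a subsemigroup, so it
has two `ℛ`-classes and two `ℒ`-classes. -/
theorem four_le_card_jClass [Finite S] (hS : SIndecomposable S) {e t : S} (he : e * e = e)
    (ht : ¬ TwoSidedDvd t e) : 4 ≤ (jClass e).ncard := by
  obtain ⟨x, y, ⟨a, b, hx⟩, ⟨c, d, hy⟩, hxy⟩ := hS.exists_not_twoSidedDvd_mul he ht
  -- `p * q` and `r * s` are idempotents `𝒟`-equivalent to `e` whose product is not in the
  -- `𝒥`-class, as it is a multiple of `x * y`. The four elements are the entries of the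
  -- resulting two-by-two egg-box.
  obtain ⟨p, hp⟩ : ∃ p, p = b * e := ⟨_, rfl⟩
  obtain ⟨q, hq⟩ : ∃ q, q = e * a * x := ⟨_, rfl⟩
  obtain ⟨r, hr⟩ : ∃ r, r = y * d * e := ⟨_, rfl⟩
  obtain ⟨s, hs⟩ : ∃ s, s = e * c := ⟨_, rfl⟩
  have hqp : q * p = e := by
    calc q * p = e * (a * x * b) * e := by simp only [hp, hq, mul_assoc]
      _ = e := by rw [hx, he, he]
  have hsr : s * r = e := by
    calc s * r = e * (c * y * d) * e := by simp only [hr, hs, mul_assoc]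
      _ = e := by rw [hy, he, he]
  have hpe : p * e = p := by rw [hp, mul_assoc, he]
  have hre : r * e = r := by rw [hr, mul_assoc, he]
  have heq : e * q = q := by rw [hq, ← mul_assoc, ← mul_assoc, he]
  have hes : e * s = s := by rw [hs, ← mul_assoc, he]
  have hqr : ¬ TwoSidedDvd (q * r) e := by
    rintro ⟨m, n, hmn⟩
    refine hxy ⟨m * e * a, d * e * n, ?_⟩
    refine Eq.trans ?_ hmn
    simp only [hq, hr, mul_assoc]
  have hqre : q * r ≠ e := fun h => hqr (h.symm ▸ twoSidedDvd_self he)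
  have hqs : q ≠ s := fun h => hqre (h ▸ hsr)
  have hpr : p ≠ r := fun h => hqre (h ▸ hqp)
  have cancel_left_q {k l : S} (h : p * k = p * l) (hk : e * k = k) (hl : e * l = l) : k = l := by
    rw [← hk, ← hl, ← hqp, mul_assoc, mul_assoc, h]
  have cancel_left_s {k l : S} (h : r * k = r * l) (hk : e * k = k) (hl : e * l = l) : k = l := by
    rw [← hk, ← hl, ← hsr, mul_assoc, mul_assoc, h]
  have cancel_right_p {k l : S} (h : k * q = l * q) (hk : k * e = k) (hl : l * e = l) : k = l := by
    rw [← hk, ← hl, ← hqp, ← mul_assoc, ← mul_assoc, h]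
  have cancel_right_r {k l : S} (h : k * s = l * s) (hk : k * e = k) (hl : l * e = l) : k = l := by
    rw [← hk, ← hl, ← hsr, ← mul_assoc, ← mul_assoc, h]
  -- Otherwise `r` and `p` would be `ℛ`-equivalent, which forces `q * r` to divide `e`.
  have hpqr : p * q * r ≠ r := by
    intro h
    refine hqr ⟨s * p, e, ?_⟩
    rw [mul_assoc s, ← mul_assoc p, h, hsr, he]
  have h1 : p * q ≠ p * s := fun h => hqs (cancel_left_q h heq hes)
  have h2 : p * q ≠ r * q := fun h => hpr (cancel_right_p h hpe hre)
  have h3 : p * q ≠ r * s := by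
    intro h
    apply hpqr
    rw [h, mul_assoc, hsr, hre]
  have h4 : p * s ≠ r * q := by
    intro h
    apply hpqr
    refine cancel_right_p ?_ (by rw [mul_assoc, hre]) hre
    calc p * q * r * q = p * (q * p) * s := by rw [mul_assoc _ r, ← h]; simp only [mul_assoc]
      _ = r * q := by rw [hqp, hpe, h]
  have h5 : p * s ≠ r * s := fun h => hpr (cancel_right_r h hpe hre)
  have h6 : r * q ≠ r * s := fun h => hqs (cancel_left_s h heq hes)
  have hcard : ({p * q, p * s, r * q, r * s} : Set S).ncard = 4 := by
    rw [Set.ncard_insert_of_notMem (by simp [h1, h2, h3]),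
      Set.ncard_insert_of_notMem (by simp [h4, h5]), Set.ncard_pair h6]
  rw [← hcard]
  apply Set.ncard_le_ncard _ (Set.toFinite _)
  have aux {k l k' l' : S} (hk : k' * k = e) (hke : k * e = k) (hl : l * l' = e) :
      k * l ∈ jClass e :=
    ⟨⟨k', l', by rw [← mul_assoc, hk, mul_assoc, hl, he]⟩, ⟨k, l, by rw [hke]⟩⟩
  rintro z (rfl | rfl | rfl | rfl)
  · exact aux hqp hpe hqp
  · exact aux hqp hpe hsr
  · exact aux hsr hre hqp
  · exact aux hsr hre hsr

/-! ### The upper bound -/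

/-- The minimal ideal of a finite semigroup is nonempty. -/
theorem exists_forall_twoSidedDvd (S : Type u) [Semigroup S] [Finite S] [Nonempty S] :
    ∃ w : S, ∀ x, TwoSidedDvd x w := by
  obtain ⟨z, hz⟩ := Finite.exists_min fun z : S => {y | TwoSidedDvd z y}.ncard
  refine ⟨z * z * z, fun x => ?_⟩
  have hsub : {y | TwoSidedDvd (z * x * z) y} ⊆ {y | TwoSidedDvd z y} :=
    fun y hy => TwoSidedDvd.of_mul_right hy
  have heq := Set.eq_of_subset_of_ncard_le hsub (hz _) (Set.toFinite _)
  have hmem : z * z * z ∈ {y | TwoSidedDvd (z * x * z) y} := heq ▸ ⟨z, z, rfl⟩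
  exact TwoSidedDvd.of_mul_right (TwoSidedDvd.of_mul_left hmem)

theorem SIndecomposable.card_subsemilattice_le [Finite S] [Nonempty S] (hS : SIndecomposable S)
    (Y : Subsemigroup S) (hY : IsSemilattice Y) :
    Nat.card Y ≤ 2 * ((Nat.card S - 1) / 4) + 1 := by
  classical
  have := Fintype.ofFinite S
  have hidem : ∀ e ∈ Y, e * e = e := fun e he => congrArg Subtype.val (hY.1 ⟨e, he⟩)
  have hcomm : ∀ e ∈ Y, ∀ f ∈ Y, e * f = f * e := fun e he f hf =>
    congrArg Subtype.val (hY.2 ⟨e, he⟩ ⟨f, hf⟩)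
  let Z : Finset S := Finset.univ.filter (· ∈ Y)
  let Z₀ : Finset S := Z.filter fun e => ∀ t, TwoSidedDvd t e
  let Z₁ : Finset S := Z.filter fun e => ¬ ∀ t, TwoSidedDvd t e
  have hZ : Nat.card Y = Z.card := by
    rw [Nat.card_eq_fintype_card]
    exact Fintype.card_subtype _
  have hZsum : Z₀.card + Z₁.card = Z.card := Finset.card_filter_add_card_filter_not _
  have hZ₀ : Z₀.card ≤ 1 := by
    rw [Finset.card_le_one]
    intro e he f hf
    simp only [Z₀, Z, Finset.mem_filter, Finset.mem_univ, true_and] at he hf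
    exact eq_of_comm_of_twoSidedDvd_mul (hidem e he.1) (hidem f hf.1) (hcomm e he.1 f hf.1)
      (he.2 _) (hf.2 _)
  have hZ₁ : ∀ e ∈ Z₁, e ∈ Y ∧ ∃ t, ¬ TwoSidedDvd t e := by
    intro e he
    simpa [Z₁, Z] using he
  let J : S → Finset S := fun e => (jClass e).toFinset
  have hJcard : ∀ e, (J e).card = (jClass e).ncard := fun e =>
    (Set.ncard_eq_toFinset_card' (jClass e)).symm
  have hJeq : ∀ {e f x}, x ∈ J e → x ∈ J f → J e = J f := by
    intro e f x he hf
    simp only [J, Set.mem_toFinset] at he hf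
    simp only [J, jClass_eq_of_mem he hf]
  have hself : ∀ e ∈ Z₁, e ∈ J e := by
    intro e he
    have := twoSidedDvd_self (hidem e (hZ₁ e he).1)
    exact Set.mem_toFinset.2 ⟨this, this⟩
  let C : Finset (Finset S) := Z₁.image J
  let d : Finset S → ℕ := fun c => (Z₁.filter fun e => J e = c).card
  have hsum : Z₁.card = ∑ c ∈ C, d c :=
    Finset.card_eq_sum_card_fiberwise fun e he => Finset.mem_image_of_mem J he
  have hd : ∀ c ∈ C, 4 * ((d c + 1) / 2) ≤ c.card := by
    intro c hc
    obtain ⟨e, he, rfl⟩ := Finset.mem_image.1 hc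
    obtain ⟨heY, t, ht⟩ := hZ₁ e he
    have h4 := four_le_card_jClass hS (hidem e heY) ht
    have hsq := card_sq_le_card_jClass (hidem e heY) (Z₁.filter fun f => J f = J e)
      (fun f hf => hidem f (hZ₁ f (Finset.mem_filter.1 hf).1).1)
      (fun f hf g hg => hcomm f (hZ₁ f (Finset.mem_filter.1 hf).1).1 g
        (hZ₁ g (Finset.mem_filter.1 hg).1).1)
      (fun f hf => by
        have hf' := Finset.mem_filter.1 hf
        have hmem := hself f hf'.1
        rw [hf'.2] at hmem
        exact Set.mem_toFinset.1 hmem)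
    rw [← hJcard] at h4 hsq
    change d (J e) ^ 2 ≤ _ at hsq
    -- `4 * ⌈d / 2⌉` is at most `4` for `d ≤ 2`, and at most `2 * d + 2 ≤ d ^ 2` for `d ≥ 3`.
    rcases Nat.lt_or_ge (d (J e)) 3 with hlt | hge
    · omega
    · have : 2 * d (J e) + 2 ≤ d (J e) ^ 2 := by nlinarith
      omega
  have hdisj : (C : Set (Finset S)).PairwiseDisjoint id := by
    intro c hc c' hc' hne
    obtain ⟨e, -, rfl⟩ := Finset.mem_image.1 hc
    obtain ⟨f, -, rfl⟩ := Finset.mem_image.1 hc'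
    exact Finset.disjoint_left.2 fun x hx hx' => hne (hJeq hx hx')
  obtain ⟨w, hw⟩ := exists_forall_twoSidedDvd S
  have hwC : w ∉ C.biUnion id := by
    intro h
    obtain ⟨c, hc, hwc⟩ := Finset.mem_biUnion.1 h
    obtain ⟨e, he, rfl⟩ := Finset.mem_image.1 hc
    obtain ⟨-, t, ht⟩ := hZ₁ e he
    exact ht ((hw t).trans (Set.mem_toFinset.1 hwc).1)
  have hlt : (C.biUnion id).card < Fintype.card S := Finset.card_lt_univ_of_notMem hwC
  rw [Finset.card_biUnion hdisj] at hlt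
  have h1 : ∑ c ∈ C, 4 * ((d c + 1) / 2) ≤ ∑ c ∈ C, c.card := Finset.sum_le_sum hd
  have h2 : ∑ c ∈ C, d c ≤ ∑ c ∈ C, 2 * ((d c + 1) / 2) :=
    Finset.sum_le_sum fun c _ => by omega
  rw [← Finset.mul_sum] at h1 h2
  simp only [id] at hlt
  rw [hZ, Nat.card_eq_fintype_card]
  omega

end JClass

/-! ### Brandt semigroups and sharpness -/

/-- The `0`-direct union of a family, indexed by `ι`, of copies of the five-element Brandt semigroup
and of a null semigroup with nonzero elements `κ`. Here `none` is the zero, and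
`some (inl (i, a, b))` is the matrix unit with row `a` and column `b` in the copy `i`. -/
def BrandtSum (ι κ : Type u) : Type u := Option ((ι × Bool × Bool) ⊕ κ)

namespace BrandtSum

variable {ι κ : Type u}

/-- The zero element. -/
def zero : BrandtSum ι κ := none

/-- The matrix unit with row `a` and column `b` in the copy `i`. -/
def unit (i : ι) (a b : Bool) : BrandtSum ι κ := some (Sum.inl (i, a, b))

/-- The nonzero elements of the null summand. -/
def null (j : κ) : BrandtSum ι κ := some (Sum.inr j)

theorem cases (x : BrandtSum ι κ) :
    x = zero ∨ (∃ i a b, x = unit i a b) ∨ ∃ j, x = null j := by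
  rcases x with _ | ⟨i, a, b⟩ | j
  exacts [Or.inl rfl, Or.inr (Or.inl ⟨i, a, b, rfl⟩), Or.inr (Or.inr ⟨j, rfl⟩)]

open Classical in
/-- Matrix units of one copy multiply as such; all other products are zero. -/
noncomputable instance : Mul (BrandtSum ι κ) where
  mul x y := match x, y with
    | some (Sum.inl (i, a, b)), some (Sum.inl (j, c, d)) =>
      if i = j ∧ b = c then some (Sum.inl (i, a, d)) else none
    | _, _ => none

theorem zero_mul (x : BrandtSum ι κ) : zero * x = zero := rfl

theorem mul_zero (x : BrandtSum ι κ) : x * zero = zero := by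
  rcases x with _ | ⟨i, a, b⟩ | j <;> rfl

theorem null_mul (j : κ) (x : BrandtSum ι κ) : null j * x = zero := rfl

theorem mul_null (x : BrandtSum ι κ) (j : κ) : x * null j = zero := by
  rcases x with _ | ⟨i, a, b⟩ | j <;> rfl

open Classical in
theorem unit_mul_unit (i j : ι) (a b c d : Bool) :
    (unit i a b * unit j c d : BrandtSum ι κ) = if i = j ∧ b = c then unit i a d else zero := rfl

noncomputable instance : Semigroup (BrandtSum ι κ) where
  mul_assoc x y z := by
    rcases cases x with rfl | ⟨i, a, b, rfl⟩ | ⟨j, rfl⟩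
    · simp only [zero_mul]
    · rcases cases y with rfl | ⟨i', a', b', rfl⟩ | ⟨j', rfl⟩
      · simp only [zero_mul, mul_zero]
      · rcases cases z with rfl | ⟨i'', a'', b'', rfl⟩ | ⟨j'', rfl⟩
        · simp only [mul_zero]
        · simp only [unit_mul_unit]
          split_ifs <;> grind [unit_mul_unit, zero_mul, mul_zero]
        · simp only [mul_null, mul_zero]
      · simp only [mul_null, null_mul, zero_mul, mul_zero]
    · simp only [null_mul, zero_mul]

theorem sIndecomposable : SIndecomposable (BrandtSum ι κ) := by
  intro T _ hT f hf
  have hsq : ∀ x, x * x = zero → f x = f zero := by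
    intro x hx
    rw [← hT.1 (f x), ← map_mul, hx]
  have hoff : ∀ i a, f (unit i a !a) = f zero := by
    intro i a
    apply hsq
    rw [unit_mul_unit, if_neg (by simp)]
  have hoff' : ∀ i a, f (unit i (!a) a) = f zero := by
    intro i a
    apply hsq
    rw [unit_mul_unit, if_neg (by simp)]
  have hall : ∀ x, f x = f zero := by
    intro x
    rcases cases x with rfl | ⟨i, a, b, rfl⟩ | ⟨j, rfl⟩
    · rfl
    · by_cases hab : b = a
      · -- A diagonal matrix unit is the product of the two off-diagonal ones.
        have : (unit i a b : BrandtSum ι κ) = unit i a (!a) * unit i (!a) a := by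
          rw [unit_mul_unit, if_pos ⟨rfl, rfl⟩, hab]
        rw [this, map_mul, hoff, hoff', hT.1]
      · rw [Bool.eq_not.2 hab]
        exact hoff i a
    · exact hsq _ (null_mul _ _)
  refine ⟨fun s t => ?_⟩
  obtain ⟨x, rfl⟩ := hf s
  obtain ⟨y, rfl⟩ := hf t
  rw [hall x, hall y]

instance [Finite ι] [Finite κ] : Finite (BrandtSum ι κ) :=
  inferInstanceAs (Finite (Option ((ι × Bool × Bool) ⊕ κ)))

theorem card [Finite ι] [Finite κ] :
    Nat.card (BrandtSum ι κ) = 4 * Nat.card ι + Nat.card κ + 1 := by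
  change Nat.card (Option ((ι × Bool × Bool) ⊕ κ)) = _
  rw [Finite.card_option, Nat.card_sum, Nat.card_prod, Nat.card_prod]
  simp only [Nat.card_eq_fintype_card (α := Bool), Fintype.card_bool]
  ring

/-- The idempotents: the zero and the diagonal matrix units. -/
def diag : Option (ι × Bool) → BrandtSum ι κ
  | none => zero
  | some (i, a) => unit i a a

theorem diag_injective : Function.Injective (diag : Option (ι × Bool) → BrandtSum ι κ) := by
  rintro (_ | ⟨i, a⟩) (_ | ⟨j, b⟩) h
  · rfl
  · cases h
  · cases h
  · cases h
    rfl

open Classical in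
theorem diag_mul_diag (x y : Option (ι × Bool)) :
    (diag x * diag y : BrandtSum ι κ) = diag (if x = y then x else none) := by
  rcases x with _ | ⟨i, a⟩
  · split_ifs <;> rfl
  · rcases y with _ | ⟨j, b⟩
    · rfl
    · simp only [diag, unit_mul_unit, Option.some.injEq, Prod.mk.injEq]
      split_ifs with h
      · rw [h.2]
      · rfl

/-- The subsemilattice of idempotents. -/
def idempotents (ι κ : Type u) : Subsemigroup (BrandtSum ι κ) where
  carrier := Set.range diag
  mul_mem' := by
    rintro _ _ ⟨x, rfl⟩ ⟨y, rfl⟩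
    exact ⟨_, (diag_mul_diag x y).symm⟩

theorem isSemilattice_idempotents : IsSemilattice (idempotents ι κ) := by
  constructor
  · rintro ⟨_, x, rfl⟩
    refine Subtype.ext (?_ : diag x * diag x = diag x)
    rw [diag_mul_diag, if_pos rfl]
  · rintro ⟨_, x, rfl⟩ ⟨_, y, rfl⟩
    refine Subtype.ext (?_ : diag x * diag y = diag y * diag x)
    rw [diag_mul_diag, diag_mul_diag]
    by_cases h : x = y
    · rw [h]
    · rw [if_neg h, if_neg (Ne.symm h)]

theorem card_idempotents [Finite ι] : Nat.card (idempotents ι κ) = 2 * Nat.card ι + 1 := by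
  change Nat.card (Set.range (diag : Option (ι × Bool) → BrandtSum ι κ)) = _
  rw [Nat.card_range_of_injective diag_injective, Finite.card_option, Nat.card_prod,
    Nat.card_eq_fintype_card (α := Bool), Fintype.card_bool, mul_comm]

end BrandtSum

theorem theorem2 :
    (∀ (S : Type u) [Semigroup S] [Finite S] [Nonempty S], SIndecomposable S →
      ∀ Y : Subsemigroup S, IsSemilattice Y →
        Nat.card Y ≤ 2 * ((Nat.card S - 1) / 4) + 1) ∧
    (∀ n : ℕ, 1 ≤ n →
      ∃ (S : Type u) (_ : Semigroup S) (_ : Finite S),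
        SIndecomposable S ∧ Nat.card S = n ∧
        ∃ Y : Subsemigroup S, IsSemilattice Y ∧
          Nat.card Y = 2 * ((Nat.card S - 1) / 4) + 1) := by
  refine ⟨fun S _ _ _ hS Y hY => hS.card_subsemilattice_le Y hY, fun n hn => ?_⟩
  have hcard : Nat.card (BrandtSum (ULift.{u} (Fin ((n - 1) / 4))) (ULift.{u} (Fin ((n - 1) % 4))))
      = n := by
    rw [BrandtSum.card, Nat.card_ulift, Nat.card_ulift, Nat.card_fin, Nat.card_fin]
    omega
  refine ⟨BrandtSum (ULift.{u} (Fin ((n - 1) / 4))) (ULift.{u} (Fin ((n - 1) % 4))),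
    inferInstance, inferInstance, BrandtSum.sIndecomposable, hcard, BrandtSum.idempotents _ _,
    BrandtSum.isSemilattice_idempotents, ?_⟩
  rw [hcard, BrandtSum.card_idempotents, Nat.card_ulift, Nat.card_fin]
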